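/- Let $\Sigma=\mathbb{H}^2/\Gamma$ be a closed oriented hyperbolic surface, where $\Gamma\cong\pi_1(\Sigma)$ acts on $\mathbb{H}^2$ freely, properly discontinuously and cocompactly by orientation-preserving isometries, and let $\Delta$ be a (finite) triangulation of $\Sigma$ with a single vertex (triangles may be glued to themselves along sides and corners), all of whose edges are essential simple closed curves. A wall is a connected component of the preimage in $\mathbb{H}^2$ of an edge of $\Delta$ (the vertex being included in the edge). Call a topologically embedded path $L:[0,\infty)\to\mathbb{H}^2$ admissible if each intersection of $L$ with a wall is transverse, $L$ meets each wall in at most one point, and $L$ meets infinitely many walls. Here transverse means that if $L(t)\in w$ with $t>0$, then just before and just after time $t$ the path lies in different components of $\mathbb{H}^2\setminus w$; nothing is required at $t=0$. Identify $\mathbb{H}^2$ with the unit disc by the Cayley transform $z\mapsto (z-i)/(z+i)$ of the upper half-plane, and its circle at infinity with $S^1$. Let $D\subset\mathbb{H}^2$ be a bounded fundamental domain for the action of $\Gamma$ (the $\Gamma$-translates of $\overline D$ cover $\mathbb{H}^2$, and distinct translates of $D$ have disjoint interiors). For each $\varepsilon>0$ there is a compact set $K\subset\mathbb{H}^2$ so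 that the following holds. Suppose that $L_1,L_2:[0,\infty)\to\mathbb{H}^2$ are admissible paths which intersect $D$, say $L_1(s_1)\in D$ and $L_2(s_2)\in D$, and that for each wall $w$ which intersects $K$, the path $L_1$ intersects $w$ at some time $t\ge s_1$ if and only if $L_2$ intersects $w$ at some time $t\ge s_2$. (For paths starting in $D$ one may take $s_1=s_2=0$, and then this says that $L_1$ intersects $w$ if and only if $L_2$ does.) Then $L_1(t)$ and $L_2(t)$ converge in the closed disc, as $t\to\infty$, to points $\xi_1,\xi_2\in S^1$, and $\xi_1,\xi_2$ have distance at most $\varepsilon$ in the angular metric on $S^1$. -/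

import Mathlib

open scoped UpperHalfPlane NNReal Topology

/-- `Γ` is the group of deck transformations of a closed orientable hyperbolic surface
`ℍ / Γ`: it acts on the hyperbolic plane by orientation preserving isometries, properly
discontinuously, cocompactly and freely (an element of `SL(2, ℝ)` counts only through its action,
so that `-1` may belong to `Γ`). -/
structure IsClosedSurfaceGroup (Γ : Subgroup (Matrix.SpecialLinearGroup (Fin 2) ℝ)) : Prop where
  properlyDiscontinuous : ProperlyDiscontinuousSMul Γ ℍ
  cocompact : CompactSpace (Quotient (MulAction.orbitRel Γ ℍ))
  free : ∀ γ : Γ, (∃ z : ℍ, γ • z = z) → ∀ z : ℍ, γ • z = z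

/-- The hyperbolic surface `ℍ / Γ`. -/
abbrev HypSurface (Γ : Subgroup (Matrix.SpecialLinearGroup (Fin 2) ℝ)) : Type :=
  Quotient (MulAction.orbitRel Γ ℍ)

/-- The covering projection `ℍ → ℍ / Γ`. -/
noncomputable def HypSurface.proj (Γ : Subgroup (Matrix.SpecialLinearGroup (Fin 2) ℝ)) (z : ℍ) : HypSurface Γ :=
  Quotient.mk (MulAction.orbitRel Γ ℍ) z

/-- A (finite) triangulation of `X` with exactly one vertex: a space obtained from triangles by
gluing their sides in such a way that all corners become one point. Every edge is a loop at the
vertex, every triangle is a map of the standard simplex whose three sides run along edges (in one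
of the two directions), and every point of `X` is either the vertex, or lies in exactly one open
edge, or in exactly one open triangle, at exactly one parameter. -/
structure OneVertexTriangulation (X : Type*) [TopologicalSpace X] where
  vertex : X
  numEdges : ℕ
  numTriangles : ℕ
  edge : Fin numEdges → Path vertex vertex
  triangle : Fin numTriangles → C(stdSimplex ℝ (Fin 3), X)
  edge_injective : ∀ i j, ∀ s ∈ Set.Ioo (0 : unitInterval) 1, ∀ t ∈ Set.Ioo (0 : unitInterval) 1,
    edge i s = edge j t → i = j ∧ s = t
  edge_ne_vertex : ∀ i, ∀ s ∈ Set.Ioo (0 : unitInterval) 1, edge i s ≠ vertex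
  triangle_injective : ∀ k l (p q : stdSimplex ℝ (Fin 3)),
    (∀ a, 0 < (p : Fin 3 → ℝ) a) → (∀ a, 0 < (q : Fin 3 → ℝ) a) →
    triangle k p = triangle l q → k = l ∧ p = q
  triangle_notMem_edge : ∀ k (p : stdSimplex ℝ (Fin 3)), (∀ a, 0 < (p : Fin 3 → ℝ) a) →
    ∀ i, triangle k p ∉ Set.range (edge i)
  /-- The side opposite to the corner `a` has the corners `a + 1` and `a + 2` (modulo 3). -/
  side : ∀ k (a : Fin 3), ∃ i,
    (∀ p : stdSimplex ℝ (Fin 3), (p : Fin 3 → ℝ) a = 0 →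
      triangle k p = (edge i).extend ((p : Fin 3 → ℝ) (a + 1))) ∨
    (∀ p : stdSimplex ℝ (Fin 3), (p : Fin 3 → ℝ) a = 0 →
      triangle k p = (edge i).extend ((p : Fin 3 → ℝ) (a + 2)))
  cover : ∀ x : X, x = vertex ∨ (∃ i, x ∈ Set.range (edge i)) ∨
    ∃ k, x ∈ Set.range (triangle k)

/-- All edges are essential, i.e. no edge is a null-homotopic loop. (They are simple closed
curves by the definition of a triangulation.) -/
def OneVertexTriangulation.EdgesEssential {X : Type*} [TopologicalSpace X]
    (T : OneVertexTriangulation X) : Prop :=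
  ∀ i, ¬ Path.Homotopic (T.edge i) (Path.refl T.vertex)

/-- The walls: the connected components of the preimages in `ℍ` of the (closed) edges. -/
def walls {Γ : Subgroup (Matrix.SpecialLinearGroup (Fin 2) ℝ)}
    (T : OneVertexTriangulation (HypSurface Γ)) : Set (Set ℍ) :=
  {w | ∃ i, ∃ z ∈ HypSurface.proj Γ ⁻¹' Set.range (T.edge i),
    w = connectedComponentIn (HypSurface.proj Γ ⁻¹' Set.range (T.edge i)) z}

/-- `L` crosses `w` transversely at time `t`: just before and just after `t` it is in
different components of the complement of `w`. At the initial time `0` of the ray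
this is no condition. -/
def CrossesAt (L : ℝ≥0 → ℍ) (w : Set ℍ) (t : ℝ≥0) : Prop :=
  ∀ᶠ s in 𝓝[<] t, ∀ᶠ u in 𝓝[>] t, L s ∉ w ∧ L u ∉ w ∧
    connectedComponentIn wᶜ (L s) ≠ connectedComponentIn wᶜ (L u)

/-- An embedded ray which meets every wall transversely and at most once, and which meets
infinitely many walls. -/
structure IsWallTransverseRay {Γ : Subgroup (Matrix.SpecialLinearGroup (Fin 2) ℝ)}
    (T : OneVertexTriangulation (HypSurface Γ)) (L : ℝ≥0 → ℍ) : Prop where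
  embedded : Topology.IsEmbedding L
  transverse : ∀ w ∈ walls T, ∀ t, L t ∈ w → CrossesAt L w t
  once : ∀ w ∈ walls T, ∀ s t, L s ∈ w → L t ∈ w → s = t
  infinite : {w ∈ walls T | ∃ t, L t ∈ w}.Infinite

/-- `D` is a bounded fundamental domain for the action of `Γ` on `ℍ`: the translates of
its closure cover `ℍ`, and distinct translates have disjoint interiors. (An open, a closed or a
half-open fundamental polygon all qualify.) -/
structure IsBoundedFundamentalDomain (Γ : Subgroup (Matrix.SpecialLinearGroup (Fin 2) ℝ))
    (D : Set ℍ) : Prop where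
  bounded : Bornology.IsBounded D
  cover : ∀ z : ℍ, ∃ γ : Γ, γ • z ∈ closure D
  disjoint : ∀ γ : Γ, (∃ z : ℍ, γ • z ≠ z) →
    Disjoint (interior D) ((fun z : ℍ => γ • z) '' interior D)

/-- The Cayley transform, which identifies `ℍ` with the Poincare disc. -/
noncomputable def toDisc (z : ℍ) : ℂ := ((z : ℂ) - Complex.I) / ((z : ℂ) + Complex.I)

/-- The ray `L` ends at the point `ξ` of the circle at infinity: it converges to `ξ` in the
closed unit disc. -/
def HasEndpoint (L : ℝ≥0 → ℍ) (ξ : Circle) : Prop :=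
  Filter.Tendsto (fun t => toDisc (L t)) Filter.atTop (𝓝 (ξ : ℂ))

/-- The angular metric on the unit circle, with values in `[0, π]`. -/
noncomputable def angularDist (ξ η : Circle) : ℝ := |Complex.arg ((ξ : ℂ) / (η : ℂ))|

/-- A subset of the hyperbolic plane has a coarse projection, with error `c`, if every point `p`
has a point `q` of the set for which the paths from `p` through `q` to the points of the set are
geodesic up to the error `c`. -/
def HasCoarseProjection (W : Set ℍ) (c : ℝ) : Prop :=
  ∀ p : ℍ, ∃ q ∈ W, ∀ x ∈ W, dist p q + dist q x ≤ dist p x + c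

namespace HasCoarseProjection

theorem mono {W : Set ℍ} {c c' : ℝ} (h : HasCoarseProjection W c) (hc : c ≤ c') :
    HasCoarseProjection W c' := fun p => by
  obtain ⟨q, hq, hx⟩ := h p
  exact ⟨q, hq, fun x hxW => (hx x hxW).trans (by gcongr)⟩

theorem of_dist_le {W : Set ℍ} {R : ℝ} (hne : W.Nonempty) (h : ∀ x ∈ W, ∀ y ∈ W, dist x y ≤ R) :
    HasCoarseProjection W (2 * R) := fun p => by
  obtain ⟨q, hq⟩ := hne
  refine ⟨q, hq, fun x hx => ?_⟩
  have h1 := dist_triangle_right p q x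
  have h2 := h q hq x hx
  linarith

theorem image {W : Set ℍ} {c : ℝ} (h : HasCoarseProjection W c) (φ : ℍ ≃ᵢ ℍ) :
    HasCoarseProjection (φ '' W) c := fun p => by
  obtain ⟨q, hq, hx⟩ := h (φ.symm p)
  refine ⟨φ q, ⟨q, hq, rfl⟩, ?_⟩
  rintro _ ⟨x, hxW, rfl⟩
  have := hx x hxW
  rwa [← φ.dist_eq (φ.symm p), ← φ.dist_eq (φ.symm p), ← φ.dist_eq q, φ.apply_symm_apply] at this

end HasCoarseProjection

/-- The point of the imaginary axis with imaginary part `r`. -/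
noncomputable def axisPoint (r : ℝ) (hr : 0 < r) : ℍ := ⟨⟨0, r⟩, hr⟩

@[simp] theorem axisPoint_re (r : ℝ) (hr : 0 < r) : (axisPoint r hr).re = 0 := rfl
@[simp] theorem axisPoint_im (r : ℝ) (hr : 0 < r) : (axisPoint r hr).im = r := rfl

theorem dist_axisPoint (r s : ℝ) (hr : 0 < r) (hs : 0 < s) :
    dist (axisPoint r hr) (axisPoint s hs) = |Real.log r - Real.log s| := by
  rw [UpperHalfPlane.dist_of_re_eq (by simp), Real.dist_eq]; simp

theorem UpperHalfPlane.norm_coe_pos (p : ℍ) : 0 < ‖(p : ℂ)‖ := norm_pos_iff.2 p.ne_zero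

theorem cosh_dist_axisPoint (p : ℍ) (a : ℝ) (ha : 0 < a) :
    Real.cosh (dist p (axisPoint a ha)) =
      Real.cosh (dist p (axisPoint ‖(p : ℂ)‖ p.norm_coe_pos)) *
        Real.cosh (dist (axisPoint ‖(p : ℂ)‖ p.norm_coe_pos) (axisPoint a ha)) := by
  have hr := p.norm_coe_pos
  have hy := p.im_pos
  have hsq : ‖(p : ℂ)‖ ^ 2 = p.re ^ 2 + p.im ^ 2 := by
    rw [Complex.sq_norm, Complex.normSq_apply]; simp [sq]
  simp only [UpperHalfPlane.cosh_dist', axisPoint_re, axisPoint_im]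
  generalize ‖(p : ℂ)‖ = r at *
  field_simp
  rw [hsq]; ring

theorem half_exp_le_cosh (x : ℝ) : Real.exp x / 2 ≤ Real.cosh x := by
  rw [Real.cosh_eq]; have := Real.exp_pos (-x); linarith

theorem add_le_of_cosh_eq_mul {A B D : ℝ} (hD : 0 ≤ D)
    (h : Real.cosh D = Real.cosh A * Real.cosh B) : A + B ≤ D + Real.log 4 := by
  have hDe : Real.cosh D ≤ Real.exp D := by
    rw [Real.cosh_eq]
    have : Real.exp (-D) ≤ Real.exp D := Real.exp_le_exp.2 (by linarith)
    linarith
  rw [← Real.exp_le_exp, Real.exp_add, Real.exp_add, Real.exp_log (by norm_num)]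
  have := mul_le_mul (half_exp_le_cosh A) (half_exp_le_cosh B) (by positivity) (by positivity)
  linarith

theorem dist_add_dist_axisPoint_le (p : ℍ) (a : ℝ) (ha : 0 < a) :
    dist p (axisPoint ‖(p : ℂ)‖ p.norm_coe_pos) +
      dist (axisPoint ‖(p : ℂ)‖ p.norm_coe_pos) (axisPoint a ha) ≤
    dist p (axisPoint a ha) + Real.log 4 :=
  add_le_of_cosh_eq_mul dist_nonneg (cosh_dist_axisPoint p a ha)

theorem pos_smul_axisPoint (u : {x : ℝ // 0 < x}) (r : ℝ) (hr : 0 < r) :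
    u • axisPoint r hr = axisPoint (u * r) (mul_pos u.2 hr) := by
  apply UpperHalfPlane.ext_re_im <;> simp

theorem log_coe_zpow (u : {x : ℝ // 0 < x}) (n : ℤ) :
    Real.log ((u ^ n : {x : ℝ // 0 < x}) : ℝ) = n * Real.log u := by
  rw [Positive.coe_zpow, Real.log_zpow]

/-- The orbit of a bounded set under a dilation is close to the imaginary axis. -/
theorem exists_hasCoarseProjection_dilation (u : {x : ℝ // 0 < x}) (hu : u ≠ 1) {C : Set ℍ}
    (hne : C.Nonempty) (hC : Bornology.IsBounded C) :
    ∃ c, HasCoarseProjection (⋃ n : ℤ, (fun z : ℍ => u ^ n • z) '' C) c := by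
  set o := axisPoint 1 one_pos
  obtain ⟨R, hR⟩ := hC.subset_closedBall o
  have hl : Real.log u ≠ 0 := fun h => by
    rcases Real.log_eq_zero.1 h with h | h | h
    · exact u.2.ne' h
    · exact hu (Subtype.ext h)
    · have := u.2; linarith
  have hclose : ∀ (n : ℤ), ∀ x ∈ C, dist (u ^ n • x) (u ^ n • o) ≤ R := fun n x hx => by
    rw [(UpperHalfPlane.isometry_pos_mul (u ^ n)).dist_eq]
    exact hR hx
  obtain ⟨c₀, hc₀⟩ := hne
  set S := |Real.log u|
  refine ⟨Real.log 4 + 2 * (R + S) + 2 * R, fun p => ?_⟩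
  set r := ‖(p : ℂ)‖
  have hr : 0 < r := p.norm_coe_pos
  set m : ℤ := ⌊Real.log r / Real.log u⌋
  have hm : dist (axisPoint r hr) (u ^ m • o) ≤ S := by
    rw [pos_smul_axisPoint, dist_axisPoint, mul_one, log_coe_zpow]
    have h1 : Real.log r - m * Real.log u = Int.fract (Real.log r / Real.log u) * Real.log u := by
      rw [Int.fract, sub_mul, div_mul_cancel₀ _ hl]
    rw [h1, abs_mul, abs_of_nonneg (Int.fract_nonneg _)]
    exact mul_le_of_le_one_left (abs_nonneg _) (Int.fract_lt_one _).le
  refine ⟨u ^ m • c₀, Set.mem_iUnion.2 ⟨m, c₀, hc₀, rfl⟩, fun x hx => ?_⟩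
  obtain ⟨n, x, hxC, rfl⟩ := Set.mem_iUnion.1 hx
  have h1 := hclose m c₀ hc₀
  have h2 := hclose n x hxC
  have h3 := dist_add_dist_axisPoint_le p ((u ^ n : {x : ℝ // 0 < x}) * 1)
    (mul_pos (u ^ n).2 one_pos)
  rw [← pos_smul_axisPoint (u ^ n) 1 one_pos] at h3
  change dist p (axisPoint r hr) + dist (axisPoint r hr) (u ^ n • o) ≤ dist p (u ^ n • o) + _ at h3
  have h4 : dist (axisPoint r hr) (u ^ m • c₀) ≤ R + S := by
    have := dist_triangle_right (axisPoint r hr) (u ^ m • c₀) (u ^ m • o)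
    linarith
  have h5 := dist_triangle p (axisPoint r hr) (u ^ m • c₀)
  have h6 := dist_triangle_left (u ^ m • c₀) (u ^ n • x) (axisPoint r hr)
  have h7 := dist_triangle_right (axisPoint r hr) (u ^ n • x) (u ^ n • o)
  have h8 := dist_triangle p (u ^ n • x) (u ^ n • o)
  have h9 := dist_triangle (axisPoint r hr) (u ^ n • o) (u ^ n • x)
  rw [dist_comm (u ^ n • o)] at h9
  change dist p (u ^ m • c₀) + dist (u ^ m • c₀) (u ^ n • x) ≤ dist p (u ^ n • x) + _
  linarith

section Disc

theorem coe_add_I_ne_zero (z : ℍ) : (z : ℂ) + Complex.I ≠ 0 := fun h => by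
  have := congrArg Complex.im h
  have hz := z.im_pos
  simp at this
  linarith

theorem continuous_toDisc : Continuous toDisc := by
  unfold toDisc
  exact (UpperHalfPlane.continuous_coe.sub continuous_const).div
    (UpperHalfPlane.continuous_coe.add continuous_const) coe_add_I_ne_zero

theorem norm_coe_add_I (z : ℍ) :
    ‖(z : ℂ) + Complex.I‖ = Real.cosh (dist z UpperHalfPlane.I / 2) * (2 * √z.im) := by
  rw [UpperHalfPlane.cosh_half_dist, Complex.dist_eq]
  have : √z.im ≠ 0 := (Real.sqrt_pos.2 z.im_pos).ne'
  simp
  field_simp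

theorem norm_toDisc_sub (z w : ℍ) : ‖toDisc z - toDisc w‖ = Real.sinh (dist z w / 2) /
    (Real.cosh (dist z UpperHalfPlane.I / 2) * Real.cosh (dist w UpperHalfPlane.I / 2)) := by
  have h : toDisc z - toDisc w =
      2 * Complex.I * (z - w) / ((z + Complex.I) * (w + Complex.I)) := by
    have := coe_add_I_ne_zero z
    have := coe_add_I_ne_zero w
    unfold toDisc
    field_simp
    ring
  have hz : √z.im ≠ 0 := (Real.sqrt_pos.2 z.im_pos).ne'
  have hw : √w.im ≠ 0 := (Real.sqrt_pos.2 w.im_pos).ne'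
  have h1 := Real.cosh_pos (dist z UpperHalfPlane.I / 2)
  have h2 := Real.cosh_pos (dist w UpperHalfPlane.I / 2)
  rw [h, norm_div, norm_mul, norm_mul, norm_mul, norm_coe_add_I, norm_coe_add_I,
    UpperHalfPlane.sinh_half_dist, Complex.dist_eq, Real.sqrt_mul z.im_pos.le]
  simp
  field_simp

theorem norm_toDisc_sub_le (z w : ℍ) : ‖toDisc z - toDisc w‖ ≤
    2 * Real.exp ((dist z w - dist z UpperHalfPlane.I - dist w UpperHalfPlane.I) / 2) := by
  have h1 := half_exp_le_cosh (dist z UpperHalfPlane.I / 2)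
  have h2 := half_exp_le_cosh (dist w UpperHalfPlane.I / 2)
  have h3 : Real.sinh (dist z w / 2) ≤ Real.exp (dist z w / 2) / 2 := by
    rw [Real.sinh_eq]; have := Real.exp_pos (-(dist z w / 2)); linarith
  have h4 := mul_le_mul h1 h2 (by positivity) (by positivity)
  rw [norm_toDisc_sub, div_le_iff₀ (by positivity)]
  calc _ ≤ Real.exp (dist z w / 2) / 2 := h3
    _ = 2 * Real.exp ((dist z w - dist z UpperHalfPlane.I - dist w UpperHalfPlane.I) / 2) *
        (Real.exp (dist z UpperHalfPlane.I / 2) / 2 *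
          (Real.exp (dist w UpperHalfPlane.I / 2) / 2)) := by
      rw [show dist z w / 2 = (dist z w - dist z UpperHalfPlane.I - dist w UpperHalfPlane.I) / 2 +
        dist z UpperHalfPlane.I / 2 + dist w UpperHalfPlane.I / 2 by ring, Real.exp_add,
        Real.exp_add]
      ring
    _ ≤ _ := by gcongr

theorem norm_toDisc (z : ℍ) : ‖toDisc z‖ =
    Real.sinh (dist z UpperHalfPlane.I / 2) / Real.cosh (dist z UpperHalfPlane.I / 2) := by
  have h := norm_toDisc_sub z UpperHalfPlane.I
  simpa [toDisc] using h

theorem norm_toDisc_lt_one (z : ℍ) : ‖toDisc z‖ < 1 := by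
  rw [norm_toDisc, div_lt_one (Real.cosh_pos _)]
  exact Real.sinh_lt_cosh _

theorem one_sub_le_norm_toDisc (z : ℍ) :
    1 - 2 * Real.exp (-dist z UpperHalfPlane.I) ≤ ‖toDisc z‖ := by
  have h1 := half_exp_le_cosh (dist z UpperHalfPlane.I / 2)
  have h2 := Real.cosh_pos (dist z UpperHalfPlane.I / 2)
  rw [norm_toDisc, le_div_iff₀ h2, sub_mul, one_mul, sub_le_comm, Real.cosh_sub_sinh]
  calc _ = 2 * Real.exp (-dist z UpperHalfPlane.I) *
      (Real.exp (dist z UpperHalfPlane.I / 2) / 2) := by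
        rw [show -(dist z UpperHalfPlane.I / 2) =
          -dist z UpperHalfPlane.I + dist z UpperHalfPlane.I / 2 by ring, Real.exp_add]
        ring
    _ ≤ _ := by gcongr

/-- The cap cut off from the disc by the line perpendicular to the direction `u` at distance `c`
from the center. -/
def discCap (u : ℂ) (c : ℝ) : Set ℍ := {z | c ≤ (toDisc z * (starRingEnd ℂ) u).re}

theorem discCap_subset (u : ℂ) {c c' : ℝ} (h : c' ≤ c) : discCap u c ⊆ discCap u c' :=
  fun _ hz => h.trans hz

theorem le_norm_toDisc_of_mem_discCap {u : ℂ} {z : ℍ} {c : ℝ} (hu : ‖u‖ = 1) (hz : z ∈ discCap u c) :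
    c ≤ ‖toDisc z‖ := by
  have h1 : c ≤ (toDisc z * (starRingEnd ℂ) u).re := hz
  have h2 := Complex.re_le_norm (toDisc z * (starRingEnd ℂ) u)
  rw [norm_mul, Complex.norm_conj, hu, mul_one] at h2
  exact h1.trans h2

theorem isPreconnected_compl_discCap (u : ℂ) (c : ℝ) : IsPreconnected (discCap u c)ᶜ := by
  have him : ∀ w : ℂ, ‖w‖ < 1 → 1 - w ≠ 0 ∧ 0 < (Complex.I * (1 + w) / (1 - w)).im := by
    intro w hw
    have h1 : 1 - w ≠ 0 := fun h => by
      rw [sub_eq_zero] at h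
      rw [← h, norm_one] at hw
      exact lt_irrefl _ hw
    refine ⟨h1, ?_⟩
    have h2 : 0 < Complex.normSq (1 - w) := Complex.normSq_pos.2 h1
    have h3 : Complex.normSq w < 1 := by
      rw [Complex.normSq_eq_norm_sq]; nlinarith [norm_nonneg w]
    rw [Complex.div_im]
    have : (Complex.I * (1 + w)).im * (1 - w).re / Complex.normSq (1 - w) -
        (Complex.I * (1 + w)).re * (1 - w).im / Complex.normSq (1 - w) =
        (1 - Complex.normSq w) / Complex.normSq (1 - w) := by
      rw [← sub_div]; congr 1
      simp [Complex.normSq_apply]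
      ring
    rw [this]
    exact div_pos (by linarith) h2
  let f : ℂ → ℍ := fun w => UpperHalfPlane.ofComplex (Complex.I * (1 + w) / (1 - w))
  have hf : ∀ w : ℂ, ‖w‖ < 1 → ((f w : ℍ) : ℂ) = Complex.I * (1 + w) / (1 - w) := fun w hw =>
    by simp only [f]; rw [UpperHalfPlane.ofComplex_apply_of_im_pos (him w hw).2]
  have hto : ∀ w : ℂ, ‖w‖ < 1 → toDisc (f w) = w := fun w hw => by
    have h1 := (him w hw).1
    rw [toDisc, hf w hw, div_eq_iff]
    · field_simp
      ring
    · rw [← hf w hw]; exact coe_add_I_ne_zero _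
  have hfrom : ∀ z : ℍ, f (toDisc z) = z := fun z => by
    apply UpperHalfPlane.ext
    have h1 := coe_add_I_ne_zero z
    have h2 := (him _ (norm_toDisc_lt_one z)).1
    rw [hf _ (norm_toDisc_lt_one z), div_eq_iff h2, toDisc]
    field_simp
    ring
  have hcont : ContinuousOn f (Metric.ball 0 1) := by
    rw [UpperHalfPlane.isEmbedding_coe.continuousOn_iff]
    refine ContinuousOn.congr (f := fun w => Complex.I * (1 + w) / (1 - w)) ?_
      (fun w hw => hf w (by simpa using hw))
    exact ContinuousOn.div (by fun_prop) (by fun_prop) (fun w hw => (him w (by simpa using hw)).1)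
  have hconv : Convex ℝ (Metric.ball (0 : ℂ) 1 ∩ {w | (w * (starRingEnd ℂ) u).re < c}) := by
    refine (convex_ball 0 1).inter (convex_halfSpace_lt ⟨fun x y => ?_, fun a x => ?_⟩ c)
    · rw [add_mul, Complex.add_re]
    · simp; ring
  have : (discCap u c)ᶜ = f '' (Metric.ball (0 : ℂ) 1 ∩ {w | (w * (starRingEnd ℂ) u).re < c}) := by
    ext z
    simp only [discCap, Set.mem_compl_iff, Set.mem_ofPred_eq, not_le, Set.mem_image]
    constructor
    · intro h
      exact ⟨toDisc z, ⟨by simpa using norm_toDisc_lt_one z, h⟩, hfrom z⟩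
    · rintro ⟨w, ⟨hw, hwc⟩, rfl⟩
      rw [hto w (by simpa using hw)]
      exact hwc
  rw [this]
  exact hconv.isPreconnected.image f (hcont.mono Set.inter_subset_left)

theorem norm_toDisc_sub_sq_le {u : ℂ} (hu : ‖u‖ = 1) {η : ℝ} {z : ℍ} (hz : z ∈ discCap u (1 - η)) :
    ‖toDisc z - u‖ ^ 2 ≤ 2 * η := by
  have h1 : ‖toDisc z‖ ^ 2 ≤ 1 := by
    have := norm_toDisc_lt_one z
    nlinarith [norm_nonneg (toDisc z)]
  have h2 : 1 - η ≤ (toDisc z * (starRingEnd ℂ) u).re := hz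
  rw [← Complex.normSq_eq_norm_sq, Complex.normSq_sub, Complex.normSq_eq_norm_sq,
    Complex.normSq_eq_norm_sq, hu]
  linarith

theorem exists_subset_discCap (c : ℝ) {η : ℝ} (hη : 0 < η) :
    ∃ N : ℝ, ∀ W : Set ℍ, HasCoarseProjection W c →
      Disjoint W (Metric.closedBall UpperHalfPlane.I N) →
      ∃ u : ℂ, ‖u‖ = 1 ∧ W ⊆ discCap u (1 - η) := by
  have hlim : Filter.Tendsto
      (fun N : ℝ => 2 * Real.exp (-N) + 2 * (Real.exp (c / 2) * Real.exp (-N)))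
      Filter.atTop (𝓝 0) := by
    have := Real.tendsto_exp_neg_atTop_nhds_zero
    simpa using (this.const_mul 2).add ((this.const_mul (Real.exp (c / 2))).const_mul 2)
  obtain ⟨N, hN, hN0⟩ := ((hlim.eventually_lt_const hη).and
    (Filter.eventually_gt_atTop 0)).exists
  refine ⟨N, fun W hW hdis => ?_⟩
  obtain ⟨q, hq, hx⟩ := hW UpperHalfPlane.I
  have hqN : N < dist q UpperHalfPlane.I := by
    by_contra h
    exact Set.disjoint_left.1 hdis hq (Metric.mem_closedBall.2 (not_lt.1 h))
  have hqpos : 0 < ‖toDisc q‖ := by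
    rw [norm_toDisc]
    exact div_pos (Real.sinh_pos_iff.2 (by linarith)) (Real.cosh_pos _)
  set u : ℂ := toDisc q / ‖toDisc q‖
  have hu : ‖u‖ = 1 := by simp [u, hqpos.ne']
  refine ⟨u, hu, fun x hxW => ?_⟩
  have h1 : (toDisc q * (starRingEnd ℂ) u).re = ‖toDisc q‖ := by
    simp only [u, map_div₀, Complex.conj_ofReal]
    rw [mul_div_assoc', Complex.mul_conj, Complex.normSq_eq_norm_sq, ← Complex.ofReal_div,
      Complex.ofReal_re]
    field_simp
  have h2 : -‖toDisc x - toDisc q‖ ≤ ((toDisc x - toDisc q) * (starRingEnd ℂ) u).re := by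
    have := (Complex.abs_re_le_norm ((toDisc x - toDisc q) * (starRingEnd ℂ) u))
    rw [norm_mul, Complex.norm_conj, hu, mul_one] at this
    exact (abs_le.1 this).1
  have h3 := norm_toDisc_sub_le x q
  have h4 := one_sub_le_norm_toDisc q
  have h5 := hx x hxW
  rw [dist_comm _ q, dist_comm q x, dist_comm _ x] at h5
  have h6 : Real.exp ((dist x q - dist x UpperHalfPlane.I - dist q UpperHalfPlane.I) / 2) ≤
      Real.exp (c / 2) * Real.exp (-N) := by
    rw [← Real.exp_add]
    exact Real.exp_le_exp.2 (by linarith)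
  have h7 : Real.exp (-dist q UpperHalfPlane.I) ≤ Real.exp (-N) := Real.exp_le_exp.2 (by linarith)
  have h8 : (toDisc x * (starRingEnd ℂ) u).re = (toDisc q * (starRingEnd ℂ) u).re +
      ((toDisc x - toDisc q) * (starRingEnd ℂ) u).re := by
    rw [← Complex.add_re]; congr 1; ring
  change 1 - η ≤ (toDisc x * (starRingEnd ℂ) u).re
  linarith

end Disc

open scoped Pointwise MatrixGroups

/-- Translation of the upper half-plane by a real number. -/
noncomputable def vaddIsometryEquiv (v : ℝ) : ℍ ≃ᵢ ℍ :=
  ⟨AddAction.toPerm v, UpperHalfPlane.isometry_real_vadd v⟩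

@[simp] theorem vaddIsometryEquiv_apply (v : ℝ) (z : ℍ) : vaddIsometryEquiv v z = v +ᵥ z := rfl

theorem exists_conj_dilation_of_upperTriangular (g : SL(2, ℝ)) (hc : g 1 0 = 0) {δ : ℝ}
    (hδ : 0 < δ) (hg : ∀ z : ℍ, δ ≤ dist z (g • z)) :
    ∃ (φ : ℍ ≃ᵢ ℍ) (u : {x : ℝ // 0 < x}), u ≠ 1 ∧ ∀ z, φ (g • z) = u • φ z := by
  obtain ⟨u, v, huv⟩ := UpperHalfPlane.exists_SL2_smul_eq_of_apply_zero_one_eq_zero g hc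
  replace huv : ∀ z : ℍ, g • z = v +ᵥ u • z := fun z => congrFun huv z
  have hu : u ≠ 1 := by
    rintro rfl
    obtain ⟨t, ht, htpos⟩ : ∃ t : ℝ, |v| / t < δ ∧ 0 < t := by
      have : Filter.Tendsto (fun t : ℝ => |v| / t) Filter.atTop (𝓝 0) :=
        tendsto_const_nhds.div_atTop Filter.tendsto_id
      exact ((this.eventually_lt_const hδ).and (Filter.eventually_gt_atTop 0)).exists
    have h1 := hg (axisPoint t htpos)
    rw [huv, one_smul] at h1
    have h2 := UpperHalfPlane.dist_le_dist_coe_div_sqrt (axisPoint t htpos)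
      (v +ᵥ axisPoint t htpos)
    rw [UpperHalfPlane.vadd_im, axisPoint_im, Real.sqrt_mul_self htpos.le, Complex.dist_eq,
      UpperHalfPlane.coe_vadd, sub_add_cancel_right, norm_neg, Complex.norm_real,
      Real.norm_eq_abs] at h2
    linarith
  have hu' : (1 : ℝ) - u ≠ 0 := fun h => hu (Subtype.ext (by simpa using (sub_eq_zero.1 h).symm))
  refine ⟨vaddIsometryEquiv (-(v / (1 - u))), u, hu, fun z => ?_⟩
  rw [huv]
  apply UpperHalfPlane.ext_re_im
  · simp; field_simp; ring
  · simp

/-- An orientation preserving isometry with displacement bounded from below is conjugate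
to a dilation. -/
theorem exists_conj_dilation (g : SL(2, ℝ)) {δ : ℝ}
    (hδ : 0 < δ) (hg : ∀ z : ℍ, δ ≤ dist z (g • z)) :
    ∃ (φ : ℍ ≃ᵢ ℍ) (u : {x : ℝ // 0 < x}), u ≠ 1 ∧ ∀ z, φ (g • z) = u • φ z := by
  by_cases hc : g 1 0 = 0
  · exact exists_conj_dilation_of_upperTriangular g hc hδ hg
  have hdet : g 0 0 * g 1 1 - g 0 1 * g 1 0 = 1 := by
    rw [← Matrix.det_fin_two, g.det_coe]
  have hdisc : 0 ≤ (g 0 0 + g 1 1) ^ 2 - 4 := by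
    by_contra! hneg
    set G := Matrix.SpecialLinearGroup.mapGL ℝ g
    have hell : G.IsElliptic := by
      change Matrix.discr _ < 0
      rw [Matrix.discr_fin_two]
      have h1 : Matrix.det (G : Matrix (Fin 2) (Fin 2) ℝ) = 1 := by simp [G]
      rw [h1, Matrix.trace_fin_two]
      simpa [G] using hneg
    have hfix : G • UpperHalfPlane.fixedPt G hell = UpperHalfPlane.fixedPt G hell :=
      (UpperHalfPlane.gl_smul_eq_self_iff_eq_fixedPt (by simp [G]) hell).2 rfl
    have h2 := hg (UpperHalfPlane.fixedPt G hell)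
    change δ ≤ dist _ (G • UpperHalfPlane.fixedPt G hell) at h2
    rw [hfix, dist_self] at h2
    linarith
  obtain ⟨x, hx⟩ : ∃ x : ℝ, g 1 0 * x ^ 2 + (g 1 1 - g 0 0) * x - g 0 1 = 0 := by
    refine ⟨(g 0 0 - g 1 1 + √((g 0 0 + g 1 1) ^ 2 - 4)) / (2 * g 1 0), ?_⟩
    have h1 := Real.sq_sqrt hdisc
    generalize √((g 0 0 + g 1 1) ^ 2 - 4) = s at *
    field_simp
    linear_combination h1 + 4 * hdet
  let B : SL(2, ℝ) := ⟨!![0, -1; 1, -x], by simp [Matrix.det_fin_two]⟩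
  have hB : (B * g * B⁻¹) 1 0 = 0 := by
    rw [Matrix.SpecialLinearGroup.coe_mul, Matrix.SpecialLinearGroup.coe_mul,
      Matrix.SpecialLinearGroup.coe_inv, Matrix.adjugate_fin_two]
    simp [B, Matrix.mul_apply, Matrix.vecMul, dotProduct, Fin.sum_univ_two]
    linear_combination hx
  obtain ⟨φ, u, hu, h⟩ := exists_conj_dilation_of_upperTriangular (B * g * B⁻¹) hB hδ fun z => by
    have := hg (B⁻¹ • z)
    rwa [← dist_smul B, smul_inv_smul, smul_smul, smul_smul] at this
  refine ⟨(IsometryEquiv.constSMul B).trans φ, u, hu, fun z => ?_⟩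
  have := h (B • z)
  rw [smul_smul, inv_mul_cancel_right, mul_smul] at this
  exact this

section SurfaceGroup

variable {Γ : Subgroup SL(2, ℝ)}

theorem proj_eq_proj_iff {z w : ℍ} :
    HypSurface.proj Γ z = HypSurface.proj Γ w ↔ ∃ γ : Γ, γ • w = z :=
  Quotient.eq''

theorem proj_smul (γ : Γ) (z : ℍ) : HypSurface.proj Γ (γ • z) = HypSurface.proj Γ z :=
  proj_eq_proj_iff.2 ⟨γ, rfl⟩

theorem surjective_proj : Function.Surjective (HypSurface.proj Γ) := Quotient.mk_surjective

namespace IsClosedSurfaceGroup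

variable (hΓ : IsClosedSurfaceGroup Γ)
include hΓ

theorem smul_eq_smul_of_exists {γ γ' : Γ} {z : ℍ} (h : γ • z = γ' • z) (w : ℍ) :
    γ • w = γ' • w := by
  have h1 : (γ'⁻¹ * γ) • z = z := by rw [mul_smul, h, inv_smul_smul]
  have h2 := hΓ.free _ ⟨z, h1⟩ w
  rwa [mul_smul, inv_smul_eq_iff] at h2

theorem isCoveringMap_proj : IsCoveringMap (HypSurface.proj Γ) := by
  have := hΓ.properlyDiscontinuous
  let G := (MulAction.toPermHom Γ ℍ).range
  have hG : ∀ σ : G, ∃ γ : Γ, ∀ z : ℍ, σ • z = γ • z := by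
    rintro ⟨_, γ, rfl⟩
    exact ⟨γ, fun z => rfl⟩
  have : ContinuousConstSMul G ℍ := ⟨fun σ => by
    obtain ⟨γ, hγ⟩ := hG σ
    simp_rw [hγ]
    exact continuous_const_smul (γ : SL(2, ℝ))⟩
  have : ProperlyDiscontinuousSMul G ℍ := ⟨fun {K L} hK hL => by
    refine ((ProperlyDiscontinuousSMul.finite_disjoint_inter_image (Γ := Γ) hK hL).image
      fun γ => (⟨MulAction.toPermHom Γ ℍ γ, γ, rfl⟩ : G)).subset ?_
    rintro ⟨_, γ, rfl⟩ h
    exact ⟨γ, h, rfl⟩⟩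
  have : IsCancelSMul G ℍ := isCancelSMul_iff_eq_one_of_smul_eq.2 fun σ z h => by
    obtain ⟨γ, hγ⟩ := hG σ
    rw [hγ] at h
    refine Subtype.ext (Equiv.ext fun w => ?_)
    exact (hγ w).trans (hΓ.free γ ⟨z, h⟩ w)
  have hq : Topology.IsQuotientMap (HypSurface.proj Γ) := isQuotientMap_quotient_mk'
  refine (hq.isQuotientCoveringMap_of_properlyDiscontinuousSMul (G := G) ?_).isCoveringMap
  intro e₁ e₂
  rw [proj_eq_proj_iff]
  constructor
  · rintro ⟨γ, h⟩
    exact ⟨⟨MulAction.toPermHom Γ ℍ γ, γ, rfl⟩, h⟩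
  · rintro ⟨σ, h⟩
    obtain ⟨γ, hγ⟩ := hG σ
    exact ⟨γ, (hγ e₂).symm.trans h⟩

theorem finite_smul_inter_nonempty {K L : Set ℍ} (hK : IsCompact K) (hL : IsCompact L) :
    {γ : Γ | (γ • K ∩ L).Nonempty}.Finite :=
  hΓ.properlyDiscontinuous.finite_disjoint_inter_image hK hL

theorem locallyFinite_smul {ι : Type*} [Finite ι] {C : ι → Set ℍ} (hC : ∀ i, IsCompact (C i)) :
    LocallyFinite fun p : ι × Γ => p.2 • C p.1 := fun x => by
  refine ⟨Metric.closedBall x 1, Metric.closedBall_mem_nhds x one_pos, ?_⟩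
  refine (Set.finite_iUnion fun i => ((hΓ.finite_smul_inter_nonempty (hC i)
    (isCompact_closedBall x 1)).image fun γ => (i, γ))).subset ?_
  rintro ⟨i, γ⟩ h
  exact Set.mem_iUnion.2 ⟨i, γ, h, rfl⟩

theorem exists_le_dist_smul {K : Set ℍ} (hK : IsCompact K) (hcov : ∀ z : ℍ, ∃ γ : Γ, γ • z ∈ K) :
    ∃ δ > 0, ∀ γ : Γ, (∃ z : ℍ, γ • z ≠ z) → ∀ z : ℍ, δ ≤ dist z (γ • z) := by
  have hK₁ : IsCompact (Metric.cthickening 1 K) := hK.cthickening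
  have hfin := hΓ.finite_smul_inter_nonempty hK₁ hK₁
  have key : ∀ᶠ δ : ℝ in 𝓝[>] 0, ∀ γ ∈ {γ : Γ | (γ • Metric.cthickening 1 K ∩
      Metric.cthickening 1 K).Nonempty}, (∃ z : ℍ, γ • z ≠ z) →
      ∀ z ∈ K, δ ≤ dist z (γ • z) := by
    refine (Filter.eventually_all_finite hfin).2 fun γ _ => ?_
    rcases K.eq_empty_or_nonempty with rfl | hne
    · simp
    by_cases hγ : ∃ z : ℍ, γ • z ≠ z
    · have hcont : Continuous fun z : ℍ => dist z (γ • z) :=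
        continuous_id.dist (continuous_const_smul (γ : SL(2, ℝ)))
      obtain ⟨z₀, -, hz₀⟩ := hK.exists_isMinOn hne hcont.continuousOn
      have hpos : 0 < dist z₀ (γ • z₀) := dist_pos.2 fun h => by
        obtain ⟨z, hz⟩ := hγ
        exact hz (hΓ.free γ ⟨z₀, h.symm⟩ z)
      filter_upwards [Ioo_mem_nhdsGT hpos] with δ hδ _ z hz
      exact hδ.2.le.trans (hz₀ hz)
    · exact Filter.Eventually.of_forall fun δ h => absurd h hγ
  obtain ⟨δ, hδ, hδ₀, hδ₁⟩ := (key.and (Ioo_mem_nhdsGT (zero_lt_one' ℝ))).exists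
  refine ⟨δ, hδ₀, fun γ hγ z => ?_⟩
  by_contra! hlt
  obtain ⟨h, hz⟩ := hcov z
  have hconj : (h * γ * h⁻¹) • h • z = h • γ • z := by
    rw [smul_smul, inv_mul_cancel_right, mul_smul]
  have hdist : dist (h • z) ((h * γ * h⁻¹) • h • z) = dist z (γ • z) := by
    rw [hconj]
    exact dist_smul (h : SL(2, ℝ)) z (γ • z)
  have hmem : (h * γ * h⁻¹) • h • z ∈ Metric.cthickening 1 K :=
    Metric.mem_cthickening_of_dist_le _ (h • z) _ _ hz (by rw [dist_comm, hdist]; linarith)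
  have h1 := hδ (h * γ * h⁻¹) ⟨_, ⟨h • z, Metric.self_subset_cthickening K hz, rfl⟩, hmem⟩ ?_ _ hz
  · rw [hdist] at h1
    linarith
  · obtain ⟨y, hy⟩ := hγ
    refine ⟨h • y, fun hh => hy ?_⟩
    rwa [smul_smul, inv_mul_cancel_right, mul_smul, smul_left_cancel_iff] at hh

end IsClosedSurfaceGroup

end SurfaceGroup

/-- A connected set covered by a locally finite family of closed sets stays in a subfamily
if it meets it, and if it does not meet the intersections of this subfamily with the rest. -/
theorem IsPreconnected.subset_biUnion_of_locallyFinite {X ι : Type*} [TopologicalSpace X]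
    {f : ι → Set X} (hf : LocallyFinite f) (hcl : ∀ i, IsClosed (f i)) {S : Set X}
    (hS : IsPreconnected S) (hcov : S ⊆ ⋃ i, f i) (J : Set ι)
    (hdis : ∀ x ∈ S, ∀ i ∈ J, ∀ j, x ∈ f i → x ∈ f j → j ∈ J)
    (hne : ∃ x ∈ S, ∃ i ∈ J, x ∈ f i) : S ⊆ ⋃ i ∈ J, f i := by
  have hclosed : ∀ I : Set ι, IsClosed (⋃ i ∈ I, f i) := fun I => by
    rw [Set.biUnion_eq_iUnion]
    exact (hf.comp_injective Subtype.val_injective).isClosed_iUnion fun i => hcl i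
  have h := (isPreconnected_iff_subset_of_disjoint_closed.1 hS) _ _ (hclosed J) (hclosed Jᶜ)
    (fun x hx => by
      obtain ⟨i, hi⟩ := Set.mem_iUnion.1 (hcov hx)
      by_cases hiJ : i ∈ J
      · exact Or.inl (Set.mem_biUnion hiJ hi)
      · exact Or.inr (Set.mem_biUnion hiJ hi))
    (by
      rw [Set.eq_empty_iff_forall_notMem]
      rintro x ⟨hx, h₁, h₂⟩
      obtain ⟨i, hi, hxi⟩ := Set.mem_iUnion₂.1 h₁
      obtain ⟨j, hj, hxj⟩ := Set.mem_iUnion₂.1 h₂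
      exact hj (hdis x hx i hi j hxi hxj))
  rcases h with h | h
  · exact h
  · obtain ⟨x, hx, i, hi, hxi⟩ := hne
    obtain ⟨j, hj, hxj⟩ := Set.mem_iUnion₂.1 (h hx)
    exact absurd (hdis x hx i hi j hxi hxj) hj

section Walls

variable {Γ : Subgroup SL(2, ℝ)} (hΓ : IsClosedSurfaceGroup Γ)
  (T : OneVertexTriangulation (HypSurface Γ))

/-- The union of the translates of a set by the powers of a group element. -/
def cyclicOrbit (g : Γ) (C : Set ℍ) : Set ℍ := ⋃ n : ℤ, g ^ n • C

theorem subset_cyclicOrbit (g : Γ) (C : Set ℍ) : C ⊆ cyclicOrbit g C := fun z hz =>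
  Set.mem_iUnion.2 ⟨0, by simpa using hz⟩

theorem isPreconnected_smul_cyclicOrbit {g : Γ} {C : Set ℍ} (hC : IsPreconnected C) {z : ℍ}
    (hz : z ∈ C) (hgz : g • z ∈ C) (γ : Γ) : IsPreconnected (γ • cyclicOrbit g C) := by
  have hsmul : ∀ (h : Γ) (A : Set ℍ), IsPreconnected A → IsPreconnected (h • A) := fun h A hA =>
    hA.image _ (continuous_const_smul (h : SL(2, ℝ))).continuousOn
  refine hsmul γ _ (IsPreconnected.iUnion_of_chain (fun n => hsmul _ _ hC) fun n => ?_)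
  refine ⟨g ^ (n + 1) • z, ?_, Set.smul_mem_smul_set hz⟩
  rw [zpow_add_one, mul_smul]
  exact Set.smul_mem_smul_set hgz

include hΓ in
theorem IsClosedSurfaceGroup.hasCoarseProjection_smul_cyclicOrbit {D : Set ℍ}
    (hD : IsBoundedFundamentalDomain Γ D) {C : Set ℍ} (hC : IsCompact C) (hne : C.Nonempty)
    (g : Γ) : ∃ c, ∀ γ : Γ, HasCoarseProjection (γ • cyclicOrbit g C) c := by
  suffices h : ∃ c, HasCoarseProjection (cyclicOrbit g C) c by
    obtain ⟨c, hc⟩ := h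
    exact ⟨c, fun γ => hc.image (IsometryEquiv.constSMul (γ : SL(2, ℝ)))⟩
  by_cases hg : ∃ z : ℍ, g • z ≠ z
  · obtain ⟨δ, hδ, hdisp⟩ := hΓ.exists_le_dist_smul hD.bounded.isCompact_closure hD.cover
    obtain ⟨φ, u, hu, hφ⟩ := exists_conj_dilation (g : SL(2, ℝ)) hδ (hdisp g hg)
    replace hφ : ∀ z, φ (g • z) = u • φ z := hφ
    have hφ' : ∀ (n : ℤ) (z : ℍ), φ (g ^ n • z) = u ^ n • φ z := by
      intro n
      induction n with
      | zero => simp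
      | succ n ih =>
        intro z
        rw [zpow_add_one, zpow_add_one, mul_smul, mul_smul, ih, hφ]
      | pred n ih =>
        intro z
        rw [zpow_sub_one, zpow_sub_one, mul_smul, mul_smul, ih, smul_left_cancel_iff,
          eq_inv_smul_iff, ← hφ, smul_inv_smul]
    obtain ⟨c, hc⟩ := exists_hasCoarseProjection_dilation u hu (hne.image φ)
      (φ.isometry.lipschitz.isBounded_image hC.isBounded)
    refine ⟨c, ?_⟩
    have := hc.image φ.symm
    convert this using 1
    rw [cyclicOrbit, Set.image_iUnion]
    refine Set.iUnion_congr fun n => ?_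
    rw [Set.image_image, Set.image_image, ← Set.image_smul]
    refine Set.image_congr fun z _ => ?_
    rw [← hφ', φ.symm_apply_apply]
  · push Not at hg
    have hg' : ∀ (n : ℤ) (z : ℍ), g ^ n • z = z := fun n z =>
      zpow_mem (K := MulAction.stabilizer Γ z) (hg z) n
    obtain ⟨R, hR⟩ := Metric.isBounded_iff.1 hC.isBounded
    have hCe : cyclicOrbit g C = C := by
      refine (Set.iUnion_subset fun n => ?_).antisymm (subset_cyclicOrbit g C)
      rintro _ ⟨z, hz, rfl⟩
      rw [← hg' n z] at hz
      exact hz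
    rw [hCe]
    exact ⟨2 * R, .of_dist_le hne fun x hx y hy => hR hx hy⟩

include hΓ

/-- The components of the preimage of an edge are the unions of the translates of lifts of
the edge by the powers of a deck transformation. -/
theorem exists_edge_arc (i : Fin T.numEdges) : ∃ (C : Set ℍ) (g : Γ), IsCompact C ∧ C.Nonempty ∧
    HypSurface.proj Γ ⁻¹' Set.range (T.edge i) = ⋃ γ : Γ, γ • C ∧
    ∀ γ : Γ, ∀ z ∈ γ • C, connectedComponentIn (HypSurface.proj Γ ⁻¹' Set.range (T.edge i)) z =
      γ • cyclicOrbit g C := by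
  obtain ⟨z₀, hz₀⟩ := surjective_proj (Γ := Γ) T.vertex
  have hstart : (T.edge i).toContinuousMap 0 = HypSurface.proj Γ z₀ := by
    rw [hz₀]; exact (T.edge i).source
  let e := hΓ.isCoveringMap_proj.liftPath (T.edge i).toContinuousMap z₀ hstart
  have he : ∀ s, HypSurface.proj Γ (e s) = T.edge i s := fun s =>
    congrFun (hΓ.isCoveringMap_proj.liftPath_lifts _ z₀ hstart) s
  obtain ⟨g, hg⟩ : ∃ g : Γ, g • e 0 = e 1 := by
    rw [← proj_eq_proj_iff, he, he, Path.source, Path.target]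
  have hends : ∀ s : unitInterval, s ∉ Set.Ioo (0 : unitInterval) 1 → ∃ n : ℤ, e s = g ^ n • e 0 := by
    intro s hs
    rcases eq_or_lt_of_le s.2.1 with h | h
    · exact ⟨0, by rw [zpow_zero, one_smul]; congr 1; exact Subtype.ext h.symm⟩
    rcases eq_or_lt_of_le s.2.2 with h' | h'
    · exact ⟨1, by rw [zpow_one, hg]; congr 1; exact Subtype.ext h'⟩
    · exact absurd ⟨h, h'⟩ hs
  have hends' : ∀ s : unitInterval, s ∉ Set.Ioo (0 : unitInterval) 1 → T.edge i s = T.vertex := by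
    intro s hs
    obtain ⟨n, hn⟩ := hends s hs
    rw [← he, hn, proj_smul, he, Path.source]
  set C := Set.range e with hCdef
  have hC : IsCompact C := isCompact_range e.continuous
  have hpre : HypSurface.proj Γ ⁻¹' Set.range (T.edge i) = ⋃ γ : Γ, γ • C := by
    ext z
    simp only [Set.mem_preimage, Set.mem_range, Set.mem_iUnion]
    constructor
    · rintro ⟨s, hs⟩
      rw [← he, eq_comm, proj_eq_proj_iff] at hs
      obtain ⟨γ, rfl⟩ := hs
      exact ⟨γ, Set.smul_mem_smul_set ⟨s, rfl⟩⟩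
    · rintro ⟨γ, _, ⟨s, rfl⟩, rfl⟩
      exact ⟨s, by rw [← he]; exact (proj_smul γ (e s)).symm⟩
  have hlf : LocallyFinite fun γ : Γ => γ • C :=
    (hΓ.locallyFinite_smul (ι := Unit) (C := fun _ => C) fun _ => hC).comp_injective
      (g := fun γ => ((), γ)) fun _ _ h => congrArg Prod.snd h
  have hcl : ∀ γ : Γ, IsClosed (γ • C) := fun γ =>
    (hC.image (continuous_const_smul (γ : SL(2, ℝ)))).isClosed
  have hoverlap : ∀ γ γ' : Γ, ∀ z : ℍ, z ∈ γ • C → z ∈ γ' • C →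
      ∃ n : ℤ, ∀ w : ℍ, γ' • w = (γ * g ^ n) • w := by
    rintro γ γ' _ ⟨_, ⟨s, rfl⟩, rfl⟩ ⟨_, ⟨t, rfl⟩, h⟩
    replace h : γ' • e t = γ • e s := h
    have hst : T.edge i t = T.edge i s := by rw [← he, ← he, ← proj_smul γ', h, proj_smul]
    by_cases hs : s ∈ Set.Ioo (0 : unitInterval) 1
    · by_cases ht : t ∈ Set.Ioo (0 : unitInterval) 1
      · obtain rfl := (T.edge_injective i i t ht s hs hst).2
        exact ⟨0, by simpa using hΓ.smul_eq_smul_of_exists h⟩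
      · rw [hends' t ht] at hst
        exact absurd hst.symm (T.edge_ne_vertex i s hs)
    · by_cases ht : t ∈ Set.Ioo (0 : unitInterval) 1
      · rw [hends' s hs] at hst
        exact absurd hst (T.edge_ne_vertex i t ht)
      · obtain ⟨m, hm⟩ := hends s hs
        obtain ⟨n, hn⟩ := hends t ht
        refine ⟨m - n, hΓ.smul_eq_smul_of_exists (z := g ^ n • e 0) ?_⟩
        rw [← hn, h, hm, hn, smul_smul, smul_smul, mul_assoc, ← zpow_add, sub_add_cancel]
  refine ⟨C, g, hC, ⟨e 0, 0, rfl⟩, hpre, fun γ z hz => ?_⟩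
  have hzpre : z ∈ HypSurface.proj Γ ⁻¹' Set.range (T.edge i) := by
    rw [hpre]; exact Set.mem_iUnion.2 ⟨γ, hz⟩
  apply Set.Subset.antisymm
  · have hsub := isPreconnected_connectedComponentIn.subset_biUnion_of_locallyFinite hlf hcl
      (S := connectedComponentIn (HypSurface.proj Γ ⁻¹' Set.range (T.edge i)) z)
      ((connectedComponentIn_subset _ _).trans hpre.subset)
      {γ' | ∃ n : ℤ, ∀ w : ℍ, γ' • w = (γ * g ^ n) • w}
      (fun x _ γ₁ h₁ γ₂ hx₁ hx₂ => by
        obtain ⟨n, hn⟩ := h₁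
        obtain ⟨m, hm⟩ := hoverlap γ₁ γ₂ x hx₁ hx₂
        refine ⟨n + m, fun w => ?_⟩
        rw [hm, mul_smul, hn, smul_smul, zpow_add, mul_assoc])
      ⟨z, mem_connectedComponentIn hzpre, γ, ⟨0, by simp⟩, hz⟩
    refine hsub.trans (Set.iUnion₂_subset ?_)
    rintro γ' ⟨n, hn⟩ _ ⟨w, hw, rfl⟩
    refine ⟨g ^ n • w, Set.mem_iUnion.2 ⟨n, Set.smul_mem_smul_set hw⟩, ?_⟩
    change γ • g ^ n • w = γ' • w
    rw [hn, mul_smul]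
  · refine IsPreconnected.subset_connectedComponentIn ?_
      (Set.smul_set_mono (subset_cyclicOrbit g C) hz) ?_
    · exact isPreconnected_smul_cyclicOrbit (isPreconnected_range e.continuous)
        (⟨0, rfl⟩ : e 0 ∈ C) (hg ▸ ⟨1, rfl⟩) γ
    · rw [hpre, cyclicOrbit, Set.smul_set_iUnion]
      refine Set.iUnion_subset fun n => ?_
      rw [smul_smul]
      exact Set.subset_iUnion (fun γ : Γ => γ • C) (γ * g ^ n)

/-- Only finitely many walls meet a given compact set. -/
theorem finite_walls_inter_nonempty {K : Set ℍ} (hK : IsCompact K) :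
    {w ∈ walls T | (w ∩ K).Nonempty}.Finite := by
  choose C g hC _ hpre hcomp using exists_edge_arc hΓ T
  refine (Set.finite_iUnion fun i => ((hΓ.finite_smul_inter_nonempty (hC i) hK).image
    fun γ => γ • cyclicOrbit (g i) (C i))).subset ?_
  rintro w ⟨⟨i, z, hz, rfl⟩, y, hyw, hyK⟩
  have hy := connectedComponentIn_subset _ _ hyw
  rw [hpre] at hy
  obtain ⟨γ, hγ⟩ := Set.mem_iUnion.1 hy
  exact Set.mem_iUnion.2 ⟨i, γ, ⟨y, hγ, hyK⟩,
    (hcomp i γ y hγ).symm.trans (connectedComponentIn_eq hyw).symm⟩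

theorem exists_hasCoarseProjection_walls {D : Set ℍ} (hD : IsBoundedFundamentalDomain Γ D) :
    ∃ c, ∀ w ∈ walls T, HasCoarseProjection w c := by
  choose C g hC hne hpre hcomp using exists_edge_arc hΓ T
  choose c hc using fun i => hΓ.hasCoarseProjection_smul_cyclicOrbit hD (hC i) (hne i) (g i)
  obtain ⟨c', hc'⟩ := (Set.finite_range c).bddAbove
  refine ⟨c', ?_⟩
  rintro w ⟨i, z, hz, rfl⟩
  rw [hpre] at hz
  obtain ⟨γ, hγ⟩ := Set.mem_iUnion.1 hz
  rw [hcomp i γ z hγ]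
  exact (hc i γ).mono (hc' ⟨i, rfl⟩)

theorem exists_triangle_lift (k : Fin T.numTriangles) :
    ∃ f : C(stdSimplex ℝ (Fin 3), ℍ), ∀ p, HypSurface.proj Γ (f p) = T.triangle k p := by
  have : ContractibleSpace (stdSimplex ℝ (Fin 3)) :=
    (convex_stdSimplex ℝ (Fin 3)).contractibleSpace ⟨_, single_mem_stdSimplex ℝ 0⟩
  obtain ⟨p₀, ⟨F⟩⟩ := id_nullhomotopic (stdSimplex ℝ (Fin 3))
  obtain ⟨z₀, hz₀⟩ := surjective_proj (T.triangle k p₀)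
  have h0 : ∀ p, ((T.triangle k).comp F.symm.toContinuousMap) (0, p) =
      HypSurface.proj Γ (ContinuousMap.const _ z₀ p) := fun p => by
    simp [hz₀]
  refine ⟨(hΓ.isCoveringMap_proj.liftHomotopy _ _ h0).comp
    ((ContinuousMap.const _ 1).prodMk (ContinuousMap.id _)), fun p => ?_⟩
  have := congrFun (hΓ.isCoveringMap_proj.liftHomotopy_lifts _ _ h0) (1, p)
  refine this.trans ?_
  simp

/-- The connected sets which avoid all walls are contained in lifts of triangles, and so have
uniformly bounded diameter. -/
theorem exists_dist_le_of_disjoint_walls (i₀ : Fin T.numEdges) :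
    ∃ R : ℝ, 0 ≤ R ∧ ∀ S : Set ℍ, IsPreconnected S → (∀ w ∈ walls T, Disjoint S w) →
      ∀ x ∈ S, ∀ y ∈ S, dist x y ≤ R := by
  choose f hf using exists_triangle_lift hΓ T
  have hC : ∀ k, IsCompact (Set.range (f k)) := fun k => isCompact_range (f k).continuous
  choose r hr using fun k => Metric.isBounded_iff.1 (hC k).isBounded
  obtain ⟨R, hR⟩ := (Set.finite_range r).bddAbove
  refine ⟨max R 0, le_max_right _ _, fun S hS hdis x hx y hy => (?_ : dist x y ≤ R).trans
    (le_max_left _ _)⟩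
  have hedge : ∀ z ∈ S, ∀ i, HypSurface.proj Γ z ∉ Set.range (T.edge i) := fun z hz i hzi =>
    Set.disjoint_left.1 (hdis _ ⟨i, z, hzi, rfl⟩) hz (mem_connectedComponentIn hzi)
  have hpos : ∀ k p, ∀ z ∈ S, HypSurface.proj Γ z = T.triangle k p →
      ∀ a, 0 < (p : Fin 3 → ℝ) a := fun k p z hz hzp a => by
    refine (p.2.1 a).lt_of_ne fun h => ?_
    have hext : ∀ i t, (T.edge i).extend t ∈ Set.range (T.edge i) := fun i t => by
      rw [← Path.extend_range]; exact ⟨t, rfl⟩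
    obtain ⟨i, h' | h'⟩ := T.side k a
    · exact hedge z hz i (by rw [hzp, h' p h.symm]; exact hext _ _)
    · exact hedge z hz i (by rw [hzp, h' p h.symm]; exact hext _ _)
  have hcov : S ⊆ ⋃ q : Fin T.numTriangles × Γ, q.2 • Set.range (f q.1) := fun z hz => by
    rcases T.cover (HypSurface.proj Γ z) with h | ⟨i, h⟩ | ⟨k, p, h⟩
    · exact absurd ⟨0, by rw [h, Path.source]⟩ (hedge z hz i₀)
    · exact absurd h (hedge z hz i)
    · rw [← hf, eq_comm, proj_eq_proj_iff] at h
      obtain ⟨γ, rfl⟩ := h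
      exact Set.mem_iUnion.2 ⟨(k, γ), Set.smul_mem_smul_set ⟨p, rfl⟩⟩
  obtain ⟨⟨k, γ⟩, hxk⟩ := Set.mem_iUnion.1 (hcov hx)
  have hsub := hS.subset_biUnion_of_locallyFinite (hΓ.locallyFinite_smul hC)
    (fun q => ((hC q.1).image (continuous_const_smul (q.2 : SL(2, ℝ)))).isClosed) hcov
    {q | q.1 = k ∧ ∀ w : ℍ, q.2 • w = γ • w} (by
      rintro z hz ⟨k₁, γ₁⟩ ⟨rfl, h₁⟩ ⟨k₂, γ₂⟩ ⟨_, ⟨p, rfl⟩, hp⟩ ⟨_, ⟨q, rfl⟩, hq⟩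
      replace hp : γ₁ • f k₁ p = z := hp
      replace hq : γ₂ • f k₂ q = z := hq
      have hp' : HypSurface.proj Γ z = T.triangle k₁ p := by rw [← hp, proj_smul, hf]
      have hq' : HypSurface.proj Γ z = T.triangle k₂ q := by rw [← hq, proj_smul, hf]
      obtain ⟨rfl, rfl⟩ := T.triangle_injective k₂ k₁ q p (hpos _ _ z hz hq') (hpos _ _ z hz hp')
        (hq'.symm.trans hp')
      exact ⟨rfl, fun w => (hΓ.smul_eq_smul_of_exists (hq.trans hp.symm) w).trans (h₁ w)⟩)
    ⟨x, hx, (k, γ), ⟨rfl, fun _ => rfl⟩, hxk⟩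
  have hmem : ∀ z ∈ S, γ⁻¹ • z ∈ Set.range (f k) := fun z hz => by
    obtain ⟨⟨k', γ'⟩, ⟨rfl, h⟩, w, hw, rfl⟩ := Set.mem_iUnion₂.1 (hsub hz)
    have : γ⁻¹ • γ' • w = w := by rw [inv_smul_eq_iff]; exact h w
    exact this.symm ▸ hw
  have := hr k (hmem x hx) (hmem y hy)
  rw [show dist (γ⁻¹ • x) (γ⁻¹ • y) = dist x y from dist_smul ((γ⁻¹ : Γ) : SL(2, ℝ)) x y] at this
  exact this.trans (hR ⟨k, rfl⟩)

end Walls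

/-- A path which moves by at most `R` on every interval that avoids a finite set of times
has bounded displacement. -/
theorem dist_le_two_pow_card_mul {X : Type*} [PseudoMetricSpace X] {L : ℝ≥0 → X}
    (hL : Continuous L) {R : ℝ} (hR : 0 ≤ R) (B : Finset ℝ≥0) : ∀ a b : ℝ≥0, a ≤ b →
    (∀ c d, a ≤ c → d ≤ b → (∀ t ∈ Set.Ioo c d, t ∉ B) →
      ∀ s ∈ Set.Ioo c d, ∀ t ∈ Set.Ioo c d, dist (L s) (L t) ≤ R) →
    dist (L a) (L b) ≤ 2 ^ B.card * R := by
  induction B using Finset.induction_on with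
  | empty =>
    intro a b hab h
    rcases hab.eq_or_lt with rfl | hab
    · simpa using hR
    have hcl : IsClosed {p : ℝ≥0 × ℝ≥0 | dist (L p.1) (L p.2) ≤ R} :=
      isClosed_le ((hL.comp continuous_fst).dist (hL.comp continuous_snd)) continuous_const
    have hsub : Set.Ioo a b ×ˢ Set.Ioo a b ⊆ {p : ℝ≥0 × ℝ≥0 | dist (L p.1) (L p.2) ≤ R} :=
      fun p hp => h a b le_rfl le_rfl (by simp) p.1 hp.1 p.2 hp.2
    have hmem : (a, b) ∈ closure (Set.Ioo a b ×ˢ Set.Ioo a b) := by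
      rw [closure_prod_eq, closure_Ioo hab.ne]
      exact ⟨Set.left_mem_Icc.2 hab.le, Set.right_mem_Icc.2 hab.le⟩
    simpa using closure_minimal hsub hcl hmem
  | insert t B ht ih =>
    intro a b hab h
    rw [Finset.card_insert_of_notMem ht, pow_succ]
    have hpow : 0 ≤ 2 ^ B.card * R := by positivity
    by_cases htab : t ∈ Set.Ioo a b
    · have h1 := ih a t htab.1.le fun c d hc hd hcd => h c d hc (hd.trans htab.2.le) fun s hs hsB =>
        (Finset.mem_insert.1 hsB).elim (fun hst => (hst ▸ hs.2.trans_le hd).false) (hcd s hs)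
      have h2 := ih t b htab.2.le fun c d hc hd hcd => h c d (htab.1.le.trans hc) hd fun s hs hsB =>
        (Finset.mem_insert.1 hsB).elim (fun hst => (hst ▸ hc.trans_lt hs.1).false) (hcd s hs)
      have h3 := dist_triangle (L a) (L t) (L b)
      linarith
    · have h1 := ih a b hab fun c d hc hd hcd => h c d hc hd fun s hs hsB =>
        (Finset.mem_insert.1 hsB).elim
          (fun hst => htab (hst ▸ ⟨hc.trans_lt hs.1, hs.2.trans_le hd⟩)) (hcd s hs)
      linarith

/-- A path which crosses `w` only at the time `t` does not return to the side of `w` from which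
it comes. -/
theorem CrossesAt.notMem_of_isPreconnected {L : ℝ≥0 → ℍ} {w : Set ℍ} {t : ℝ≥0}
    (hcross : CrossesAt L w t) (hL : Continuous L) (honce : ∀ s, L s ∈ w → s = t) {P : Set ℍ}
    (hP : IsPreconnected P) (hPw : P ⊆ wᶜ) {s u : ℝ≥0} (hst : s < t) (htu : t < u)
    (hs : L s ∈ P) : L u ∉ P := fun hu => by
  have hcomp : ∀ {A : Set ℍ}, IsPreconnected A → A ⊆ wᶜ → ∀ {x y : ℍ}, x ∈ A → y ∈ A →
      connectedComponentIn wᶜ x = connectedComponentIn wᶜ y := fun hA hAw _ _ hx hy =>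
    connectedComponentIn_eq (hA.subset_connectedComponentIn hx hAw hy)
  have hne₁ : (𝓝[<] t).NeBot := nhdsLT_neBot_of_exists_lt ⟨s, hst⟩
  have hne₂ : (𝓝[>] t).NeBot := nhdsGT_neBot_of_exists_gt ⟨u, htu⟩
  obtain ⟨s', hs', hs'mem⟩ := (hcross.and (Ico_mem_nhdsLT hst)).exists
  obtain ⟨u', ⟨-, -, hne⟩, hu'mem⟩ := (hs'.and (Ioc_mem_nhdsGT htu)).exists
  have h1 := hcomp (isPreconnected_Ico.image L hL.continuousOn)
    (by rintro _ ⟨v, hv, rfl⟩ hvw; exact hv.2.ne (honce v hvw))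
    (Set.mem_image_of_mem L (Set.left_mem_Ico.2 hst)) (Set.mem_image_of_mem L hs'mem)
  have h2 := hcomp (isPreconnected_Ioc.image L hL.continuousOn)
    (by rintro _ ⟨v, hv, rfl⟩ hvw; exact hv.1.ne' (honce v hvw))
    (Set.mem_image_of_mem L (Set.right_mem_Ioc.2 htu)) (Set.mem_image_of_mem L hu'mem)
  exact hne (h1.symm.trans ((hcomp hP hPw hs hu).trans h2))

theorem exists_norm_toDisc_le {D : Set ℍ} (hD : Bornology.IsBounded D) :
    ∃ ρ < 1, ∀ z ∈ D, ‖toDisc z‖ ≤ ρ := by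
  rcases (closure D).eq_empty_or_nonempty with h | h
  · exact ⟨0, one_pos, fun z hz => by simpa [h] using subset_closure hz⟩
  · obtain ⟨z₀, -, hz₀⟩ := hD.isCompact_closure.exists_isMaxOn h continuous_toDisc.norm.continuousOn
    exact ⟨_, norm_toDisc_lt_one z₀, fun z hz => hz₀ (subset_closure hz)⟩

namespace IsWallTransverseRay

variable {Γ : Subgroup SL(2, ℝ)} {T : OneVertexTriangulation (HypSurface Γ)} {L : ℝ≥0 → ℍ}

theorem mem_discCap (h : IsWallTransverseRay T L) {w : Set ℍ} (hw : w ∈ walls T) {u : ℂ}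
    {c : ℝ} (hu : ‖u‖ = 1) (hwu : w ⊆ discCap u c) {s t : ℝ≥0} (hst : s ≤ t) (ht : L t ∈ w)
    (hs : ‖toDisc (L s)‖ < c) {v : ℝ≥0} (hv : t < v) : L v ∈ discCap u c := by
  have hs' : L s ∈ (discCap u c)ᶜ := fun h' => (hs.trans_le (le_norm_toDisc_of_mem_discCap hu h')).false
  have hst' : s < t := hst.lt_of_ne fun h' => hs' (hwu (h' ▸ ht))
  by_contra hv'
  exact (h.transverse w hw t ht).notMem_of_isPreconnected h.embedded.continuous
    (fun r hr => h.once w hw r t hr ht) (isPreconnected_compl_discCap u c)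
    (Set.compl_subset_compl.2 hwu) hst' hv hs' hv'

/-- The ray meets a wall outside a given finite set `F` before it gets far away. -/
theorem exists_wall_notMem (hΓ : IsClosedSurfaceGroup Γ) (h : IsWallTransverseRay T L) {R : ℝ}
    (hR₀ : 0 ≤ R) (hR : ∀ S : Set ℍ, IsPreconnected S → (∀ w ∈ walls T, Disjoint S w) →
      ∀ x ∈ S, ∀ y ∈ S, dist x y ≤ R) (F : Finset (Set ℍ)) (s : ℝ≥0) :
    ∃ w ∈ walls T, w ∉ F ∧ ∃ t, s ≤ t ∧ L t ∈ w ∧ dist (L s) (L t) ≤ 2 ^ F.card * R := by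
  classical
  have hL := h.embedded.continuous
  have hcpt : ∀ a b, IsCompact (L '' Set.Icc a b) := fun a b => isCompact_Icc.image hL
  obtain ⟨w₁, ⟨hw₁, t₁, ht₁⟩, hw₁'⟩ := h.infinite.exists_notMem_finite
    ((finite_walls_inter_nonempty hΓ T (hcpt 0 s)).union F.finite_toSet)
  have hst₁ : s ≤ t₁ := by
    by_contra! hlt
    exact hw₁' (Or.inl ⟨hw₁, L t₁, ht₁, t₁, ⟨zero_le, hlt.le⟩, rfl⟩)
  let τ : Set ℍ → ℝ≥0 := fun w => if hw : ∃ t, L t ∈ w then hw.choose else 0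
  have hτ : ∀ w ∈ walls T, ∀ t, L t ∈ w → τ w = t := fun w hw t ht => by
    have hex : ∃ t, L t ∈ w := ⟨t, ht⟩
    simp only [τ, dif_pos hex]
    exact h.once w hw _ _ hex.choose_spec ht
  let A : Set ℝ≥0 := {t | t ∈ Set.Icc s t₁ ∧ ∃ w ∈ walls T, w ∉ F ∧ L t ∈ w}
  have hA : A.Finite := by
    refine ((finite_walls_inter_nonempty hΓ T (hcpt s t₁)).image τ).subset ?_
    rintro t ⟨ht, w, hw, -, htw⟩
    exact ⟨w, ⟨hw, L t, htw, t, ht, rfl⟩, hτ w hw t htw⟩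
  obtain ⟨t, ⟨⟨hst, htt₁⟩, w, hw, hwF, htw⟩, hmin⟩ := hA.exists_minimal
    ⟨t₁, ⟨hst₁, le_rfl⟩, w₁, hw₁, fun hF => hw₁' (Or.inr hF), ht₁⟩
  refine ⟨w, hw, hwF, t, hst, htw, ?_⟩
  refine (dist_le_two_pow_card_mul hL hR₀ (F.image τ) s t hst ?_).trans ?_
  · intro c d hc hd hcd x hx y hy
    refine hR (L '' Set.Ioo c d) (isPreconnected_Ioo.image L hL.continuousOn) ?_ _
      (Set.mem_image_of_mem L hx) _ (Set.mem_image_of_mem L hy)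
    intro w' hw'
    rw [Set.disjoint_left]
    rintro _ ⟨v, hv, rfl⟩ hvw'
    by_cases hF : w' ∈ F
    · exact hcd v hv (Finset.mem_image.2 ⟨w', hF, hτ w' hw' v hvw'⟩)
    · have hvt : v < t := hv.2.trans_le hd
      have hvA : v ∈ A := ⟨⟨hc.trans hv.1.le, hvt.le.trans htt₁⟩, w', hw', hF, hvw'⟩
      exact (hvt.trans_le (hmin hvA hvt.le)).false
  · have := pow_le_pow_right₀ (one_le_two (α := ℝ)) (Finset.card_image_le (s := F) (f := τ))
    gcongr

end IsWallTransverseRay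

/-- A ray which is eventually contained in arbitrarily small caps has an endpoint. -/
theorem exists_hasEndpoint {L : ℝ≥0 → ℍ}
    (h : ∀ η > 0, ∃ u : ℂ, ‖u‖ = 1 ∧ ∀ᶠ t in Filter.atTop, L t ∈ discCap u (1 - η)) :
    ∃ ξ : Circle, HasEndpoint L ξ := by
  have hcauchy : CauchySeq fun t => toDisc (L t) := by
    refine Metric.cauchySeq_iff'.2 fun ε hε => ?_
    obtain ⟨u, hu, hev⟩ := h (ε ^ 2 / 32) (by positivity)
    obtain ⟨t₀, ht₀⟩ := Filter.eventually_atTop.1 hev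
    have hclose : ∀ t ≥ t₀, ‖toDisc (L t) - u‖ ≤ ε / 4 := fun t ht => by
      have := norm_toDisc_sub_sq_le hu (ht₀ t ht)
      exact le_of_sq_le_sq (by linarith) (by positivity)
    refine ⟨t₀, fun t ht => ?_⟩
    have h1 := hclose t ht
    have h2 := hclose t₀ le_rfl
    rw [← dist_eq_norm] at h1 h2
    have := dist_triangle_right (toDisc (L t)) (toDisc (L t₀)) u
    linarith
  obtain ⟨ζ, hζ⟩ := cauchySeq_tendsto_of_complete hcauchy
  have hnorm : Filter.Tendsto (fun t => ‖toDisc (L t)‖) Filter.atTop (𝓝 1) := by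
    refine tendsto_order.2 ⟨fun a ha => ?_, fun a ha => ?_⟩
    · obtain ⟨u, hu, hev⟩ := h ((1 - a) / 2) (by linarith)
      filter_upwards [hev] with t ht
      have := le_norm_toDisc_of_mem_discCap hu ht
      linarith
    · exact Filter.Eventually.of_forall fun t => (norm_toDisc_lt_one _).trans ha
  exact ⟨⟨ζ, mem_sphere_zero_iff_norm.2 (tendsto_nhds_unique hζ.norm hnorm)⟩, hζ⟩

theorem HasEndpoint.norm_sub_sq_le {L : ℝ≥0 → ℍ} {ξ : Circle} (h : HasEndpoint L ξ) {u : ℂ}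
    (hu : ‖u‖ = 1) {η : ℝ} (hev : ∀ᶠ t in Filter.atTop, L t ∈ discCap u (1 - η)) :
    ‖(ξ : ℂ) - u‖ ^ 2 ≤ 2 * η :=
  le_of_tendsto (((h.sub_const u).norm).pow 2) (hev.mono fun _ ht => norm_toDisc_sub_sq_le hu ht)

theorem exists_angularDist_le {ε : ℝ} (hε : 0 < ε) :
    ∃ δ > 0, ∀ ξ η : Circle, ‖(ξ : ℂ) - η‖ < δ → angularDist ξ η ≤ ε := by
  have hcont : ContinuousAt Complex.arg 1 := Complex.continuousAt_arg Complex.one_mem_slitPlane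
  obtain ⟨δ, hδ, h⟩ := Metric.continuousAt_iff.1 hcont ε hε
  refine ⟨δ, hδ, fun ξ η hξη => ?_⟩
  have hη : (η : ℂ) ≠ 0 := η.coe_ne_zero
  have h1 : dist ((ξ : ℂ) / η) 1 < δ := by
    rw [dist_eq_norm, div_sub_one hη, norm_div, Circle.norm_coe η, div_one]
    exact hξη
  have := h h1
  rw [Complex.arg_one, dist_zero_right, Real.norm_eq_abs] at this
  exact this.le

theorem mainTheorem4 (Γ : Subgroup (Matrix.SpecialLinearGroup (Fin 2) ℝ))
    (hΓ : IsClosedSurfaceGroup Γ)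
    (T : OneVertexTriangulation (HypSurface Γ)) (hT : T.EdgesEssential)
    (D : Set ℍ) (hD : IsBoundedFundamentalDomain Γ D) (ε : ℝ) (hε : 0 < ε) :
    ∃ K : Set ℍ, IsCompact K ∧
      ∀ L₁ L₂ : ℝ≥0 → ℍ, IsWallTransverseRay T L₁ → IsWallTransverseRay T L₂ →
        ∀ s₁ s₂ : ℝ≥0, L₁ s₁ ∈ D → L₂ s₂ ∈ D →
          (∀ w ∈ walls T, (w ∩ K).Nonempty →
            ((∃ t, s₁ ≤ t ∧ L₁ t ∈ w) ↔ (∃ t, s₂ ≤ t ∧ L₂ t ∈ w))) →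
          ∃ ξ₁ ξ₂ : Circle, HasEndpoint L₁ ξ₁ ∧ HasEndpoint L₂ ξ₂ ∧ angularDist ξ₁ ξ₂ ≤ ε := by
  classical
  by_cases hwalls : (walls T).Nonempty
  swap
  · refine ⟨∅, isCompact_empty, fun L₁ _ h₁ => ?_⟩
    obtain ⟨w, hw, -⟩ := h₁.infinite.nonempty
    exact absurd ⟨w, hw⟩ hwalls
  obtain ⟨_, i₀, -⟩ := hwalls
  obtain ⟨R, hR₀, hR⟩ := exists_dist_le_of_disjoint_walls hΓ T i₀
  obtain ⟨c, hc⟩ := exists_hasCoarseProjection_walls hΓ T hD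
  obtain ⟨ρ, hρ, hDρ⟩ := exists_norm_toDisc_le hD.bounded
  obtain ⟨r, hDr⟩ := hD.bounded.subset_closedBall UpperHalfPlane.I
  have hcaps : ∀ η > 0, ∃ F : Finset (Set ℍ), ∀ w ∈ walls T, w ∉ F →
      ∃ u : ℂ, ‖u‖ = 1 ∧ w ⊆ discCap u (1 - η) := fun η hη => by
    obtain ⟨N, hN⟩ := exists_subset_discCap c hη
    refine ⟨(finite_walls_inter_nonempty hΓ T
      (isCompact_closedBall UpperHalfPlane.I N)).toFinset, fun w hw hwF => hN w (hc w hw) ?_⟩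
    rw [Set.disjoint_iff_inter_eq_empty, ← Set.not_nonempty_iff_eq_empty]
    exact fun hne => hwF ((Set.Finite.mem_toFinset _).2 ⟨hw, hne⟩)
  have hafter : ∀ L : ℝ≥0 → ℍ, IsWallTransverseRay T L → ∀ s, L s ∈ D → ∀ η < 1 - ρ,
      ∀ w ∈ walls T, ∀ u : ℂ, ‖u‖ = 1 → w ⊆ discCap u (1 - η) → (∃ t, s ≤ t ∧ L t ∈ w) →
      ∀ᶠ t in Filter.atTop, L t ∈ discCap u (1 - η) := by
    rintro L hL s hs η hη w hw u hu hwu ⟨t, hst, ht⟩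
    filter_upwards [Filter.eventually_gt_atTop t] with v hv
    exact hL.mem_discCap hw hu hwu hst ht (by linarith [hDρ _ hs]) hv
  have hend : ∀ L : ℝ≥0 → ℍ, IsWallTransverseRay T L → ∀ s, L s ∈ D →
      ∃ ξ : Circle, HasEndpoint L ξ := fun L hL s hs => by
    refine exists_hasEndpoint fun η hη => ?_
    have hη' : 0 < min η ((1 - ρ) / 2) := lt_min hη (by linarith)
    obtain ⟨F, hF⟩ := hcaps _ hη'
    obtain ⟨w, hw, hwF, t, hst, ht, -⟩ := hL.exists_wall_notMem hΓ hR₀ hR F s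
    obtain ⟨u, hu, hwu⟩ := hF w hw hwF
    refine ⟨u, hu, (hafter L hL s hs _ (by linarith [min_le_right η ((1 - ρ) / 2)]) w hw u hu hwu
      ⟨t, hst, ht⟩).mono fun v hv => ?_⟩
    exact discCap_subset u (by linarith [min_le_left η ((1 - ρ) / 2)]) hv
  obtain ⟨δ, hδ, hang⟩ := exists_angularDist_le hε
  set η := min (δ ^ 2 / 32) ((1 - ρ) / 2)
  have hη : 0 < η := lt_min (by positivity) (by linarith)
  have hηδ : η ≤ δ ^ 2 / 32 := min_le_left _ _
  have hηρ : η < 1 - ρ := (min_le_right _ _).trans_lt (by linarith)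
  obtain ⟨F, hF⟩ := hcaps η hη
  refine ⟨Metric.closedBall UpperHalfPlane.I (r + 2 ^ F.card * R), isCompact_closedBall _ _,
    fun L₁ L₂ h₁ h₂ s₁ s₂ hs₁ hs₂ hiff => ?_⟩
  obtain ⟨ξ₁, hξ₁⟩ := hend L₁ h₁ s₁ hs₁
  obtain ⟨ξ₂, hξ₂⟩ := hend L₂ h₂ s₂ hs₂
  refine ⟨ξ₁, ξ₂, hξ₁, hξ₂, hang ξ₁ ξ₂ ?_⟩
  obtain ⟨w, hw, hwF, t, hst, ht, hdist⟩ := h₁.exists_wall_notMem hΓ hR₀ hR F s₁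
  obtain ⟨u, hu, hwu⟩ := hF w hw hwF
  have hwK : (w ∩ Metric.closedBall UpperHalfPlane.I (r + 2 ^ F.card * R)).Nonempty := by
    refine ⟨L₁ t, ht, ?_⟩
    have h1 : dist (L₁ s₁) UpperHalfPlane.I ≤ r := hDr hs₁
    have h2 := dist_triangle_left (L₁ t) UpperHalfPlane.I (L₁ s₁)
    exact Metric.mem_closedBall.2 (by linarith)
  have hclose : ∀ (L : ℝ≥0 → ℍ) (ξ : Circle) (s : ℝ≥0), IsWallTransverseRay T L → L s ∈ D →
      HasEndpoint L ξ → (∃ t, s ≤ t ∧ L t ∈ w) → ‖(ξ : ℂ) - u‖ ≤ δ / 4 := by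
    intro L ξ s hL hs hξ hex
    have := hξ.norm_sub_sq_le hu (hafter L hL s hs η hηρ w hw u hu hwu hex)
    exact le_of_sq_le_sq (by linarith) (by positivity)
  have hd₁ := hclose L₁ ξ₁ s₁ h₁ hs₁ hξ₁ ⟨t, hst, ht⟩
  have hd₂ := hclose L₂ ξ₂ s₂ h₂ hs₂ hξ₂ ((hiff w hw hwK).1 ⟨t, hst, ht⟩)
  rw [← dist_eq_norm] at hd₁ hd₂ ⊢
  have := dist_triangle_right (ξ₁ : ℂ) ξ₂ u
  linarith
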